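/- Let $X$ be a compact (connected) Riemann surface with canonical bundle $K$, and fix a square root $K^{1/2}$ of $K$. Let $G$ be a connected complex semisimple Lie group with Lie algebra $\mathfrak g$, let $(\mathbb V,\omega)$ be a finite-dimensional complex symplectic vector space, and let $\rho:G\to Sp(\mathbb V,\omega)$ be a holomorphic symplectic representation. Fix a non-degenerate $\mathrm{Ad}$-invariant bilinear form $B$ on $\mathfrak g$ and let $\mu:\mathbb V\to\mathfrak g$ be the moment map, i.e. the quadratic $G$-equivariant map with $$B(\mu(v),\xi)=\tfrac12\,\omega(\rho(\xi)v,v)\qquad(v\in\mathbb V,\ \xi\in\mathfrak g).$$ For a holomorphic principal $G$-bundle $P$ on $X$ and a holomorphic section $\psi$ of $P(\mathbb V)\otimes K^{1/2}$, where $P(\mathbb V)$ is the vector bundle associated to $P$ via $\rho$, the map $v\otimes s\mapsto\mu(v)\otimes s^2$ gives a Higgs field $\mu(\psi)\in H^0(X,\mathrm{Ad}(P)\otimes K)$. (Semi)stability. Let $r:G\to GL(\mathbb W)$ be a finite-dimensional holomorphic representation, $L$ a holomorphic line bundle on $X$ and $\varphi\in H^0(X,P(\mathbb W)\otimes L)$.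 Let $Q\subseteq G$ be a parabolic subgroup with Lie algebra $\mathfrak q$. A holomorphic character $\chi:Q\to\mathbb C^\times$ is anti-dominant if it is trivial on the centre of $Q$ and $d\chi(h_\alpha)\le 0$ for every Cartan subalgebra $\mathfrak t\subseteq\mathfrak q$ of $\mathfrak g$ and every root $\alpha$ of $(\mathfrak g,\mathfrak t)$ with $\mathfrak g_\alpha\subseteq\mathfrak q$, where $h_\alpha$ is the coroot of $\alpha$. Let $s_\chi$ be the element of the centre $\mathfrak z_{\mathfrak l}$ of a Levi subalgebra $\mathfrak l$ of $\mathfrak q$ that corresponds to $d\chi|_{\mathfrak z_{\mathfrak l}}$ under the Killing form of $\mathfrak g$, and put $$\mathbb W_\chi^-=\{w\in\mathbb W : r(e^{ts_\chi})w \text{ is bounded as } t\to+\infty\},$$ a $Q$-invariant subspace that does not depend on the choice of $\mathfrak l$. For a holomorphic reduction $\sigma\in H^0(X,P/Q)$ of the structure group, with associated principal $Q$-bundle $P_\sigma\subseteq P$, let $\deg(P)(\sigma,\chi)$ be the degree of the line bundle $P_\sigma\times_\chi\mathbb C$. The pair $(P,\varphi)$ is semistable if for all parabolic subgroups $Q$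 of $G$, all reductions $\sigma\in H^0(X,P/Q)$ and all non-trivial anti-dominant characters $\chi$ of $Q$ such that $\varphi$ is a section of $(P_\sigma\times_Q\mathbb W_\chi^-)\otimes L$, one has $\deg(P)(\sigma,\chi)\ge 0$; it is stable if for proper $Q$ the inequality is always strict. For $(r,L)=(\rho,K^{1/2})$ this is (semi)stability of the pair $(P,\psi)$, and for $(r,L)=(\mathrm{Ad},K)$ it is (semi)stability of a $G$-Higgs bundle $(P,\Phi)$. Proposition. Let $P$ be a holomorphic principal $G$-bundle on $X$ and let $\psi$ be a holomorphic section of $P(\mathbb V)\otimes K^{1/2}$. If the Higgs bundle $(P,\mu(\psi))$ is semistable, then the pair $(P,\psi)$ is semistable; and if $(P,\mu(\psi))$ is stable, then $(P,\psi)$ is stable. -/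

import Mathlib

open Bundle Set Asymptotics
open scoped Manifold ContDiff Topology TensorProduct

set_option linter.unusedSectionVars false

noncomputable section

namespace HiggsPair

/-! ### Complex Lie groups: adjoint action and one-parameter subgroups -/

section LieGroup

variable (E : Type*) [NormedAddCommGroup E] [NormedSpace ℂ E]
  (G : Type*) [TopologicalSpace G] [ChartedSpace E G] [Group G]

/-- The Lie algebra `𝔤` of the complex Lie group `G` (modelled on `E`). -/
abbrev LieAlg : Type _ := GroupLieAlgebra 𝓘(ℂ, E) G

instance instFiniteDimensionalLieAlg [FiniteDimensional ℂ E] : FiniteDimensional ℂ (LieAlg E G) :=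
  inferInstanceAs (FiniteDimensional ℂ E)

variable {G}

/-- The differential at `1` of the conjugation `h ↦ g h g⁻¹`, as an endomorphism of `𝔤`. -/
def adMap (g : G) : LieAlg E G →ₗ[ℂ] LieAlg E G :=
  (mfderiv 𝓘(ℂ, E) 𝓘(ℂ, E) (fun h : G => g * h * g⁻¹) 1).toLinearMap

variable {E}

/-- `γ : ℂ → G` is the holomorphic one-parameter subgroup `z ↦ exp (z s)`. -/
structure IsOneParameterSubgroup (γ : ℂ → G) (s : LieAlg E G) : Prop where
  holomorphic : ContMDiff 𝓘(ℂ) 𝓘(ℂ, E) ω γ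
  map_add : ∀ a b, γ (a + b) = γ a * γ b
  deriv : mfderiv 𝓘(ℂ) 𝓘(ℂ, E) γ 0 (1 : ℂ) = s

end LieGroup

/-! ### Holomorphic representations -/

section Rep

variable (E : Type*) [NormedAddCommGroup E] [NormedSpace ℂ E]
  (G : Type*) [TopologicalSpace G] [ChartedSpace E G] [Group G]
  (W : Type*) [AddCommGroup W] [Module ℂ W]

/-- A linear representation of `G` on the (finite-dimensional) complex vector space `W` with
holomorphic matrix coefficients. -/
structure HolRep where
  rep : Representation ℂ G W
  holomorphic : ∀ (l : Module.Dual ℂ W) (w : W),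
    ContMDiff 𝓘(ℂ, E) 𝓘(ℂ) ω (fun g : G => l (rep g w))

variable {E G W}

namespace HolRep

lemma mdifferentiableAt (r : HolRep E G W) (l : Module.Dual ℂ W) (w : W) (g : G) :
    MDifferentiableAt 𝓘(ℂ, E) 𝓘(ℂ) (fun g : G => l (r.rep g w)) g :=
  ((r.holomorphic l w).mdifferentiable (by simp)) g

/-- The derivative of a matrix coefficient at `1` in the direction `ξ`. -/
def coeffDeriv (r : HolRep E G W) (ξ : LieAlg E G) (l : Module.Dual ℂ W) (w : W) : ℂ :=
  mfderiv 𝓘(ℂ, E) 𝓘(ℂ) (fun g : G => l (r.rep g w)) 1 ξ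

lemma coeffDeriv_add_left (r : HolRep E G W) (ξ : LieAlg E G) (l l' : Module.Dual ℂ W) (w : W) :
    r.coeffDeriv ξ (l + l') w = r.coeffDeriv ξ l w + r.coeffDeriv ξ l' w := by
  have := ((r.mdifferentiableAt l w 1).hasMFDerivAt.add
    (r.mdifferentiableAt l' w 1).hasMFDerivAt).mfderiv
  exact congrArg (fun f => f ξ) this

lemma coeffDeriv_add_right (r : HolRep E G W) (ξ : LieAlg E G) (l : Module.Dual ℂ W) (w w' : W) :
    r.coeffDeriv ξ l (w + w') = r.coeffDeriv ξ l w + r.coeffDeriv ξ l w' := by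
  have := ((r.mdifferentiableAt l w 1).hasMFDerivAt.add
    (r.mdifferentiableAt l w' 1).hasMFDerivAt).mfderiv
  have h : (fun g : G => l (r.rep g (w + w'))) =
      (fun g : G => l (r.rep g w)) + (fun g : G => l (r.rep g w')) := by
    ext g; simp
  unfold coeffDeriv
  rw [h]
  exact congrArg (fun f => f ξ) this

lemma coeffDeriv_smul_left (r : HolRep E G W) (ξ : LieAlg E G) (c : ℂ) (l : Module.Dual ℂ W)
    (w : W) : r.coeffDeriv ξ (c • l) w = c * r.coeffDeriv ξ l w := by
  have := ((r.mdifferentiableAt l w 1).hasMFDerivAt.const_smul c).mfderiv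
  exact congrArg (fun f => f ξ) this

lemma coeffDeriv_smul_right (r : HolRep E G W) (ξ : LieAlg E G) (c : ℂ) (l : Module.Dual ℂ W)
    (w : W) : r.coeffDeriv ξ l (c • w) = c * r.coeffDeriv ξ l w := by
  rw [← coeffDeriv_smul_left]
  have h : (fun g : G => l (r.rep g (c • w))) = (fun g : G => (c • l) (r.rep g w)) := by
    ext g; simp
  unfold coeffDeriv
  rw [h]
  rfl

/-- The subspace `W_s⁻` of the vectors `w` such that `r(exp (t s)) w` is bounded as `t → ∞`,
`t` real (boundedness in the finite-dimensional space `W` is tested on linear functionals). -/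
def boundedSubspace (r : HolRep E G W) (s : LieAlg E G) : Submodule ℂ W where
  carrier := {w | ∀ γ : ℂ → G, IsOneParameterSubgroup γ s → ∀ l : Module.Dual ℂ W,
    (fun t : ℝ => l (r.rep (γ t) w)) =O[Filter.atTop] (fun _ => (1 : ℝ))}
  add_mem' := by
    intro a b ha hb γ hγ l
    simpa using (ha γ hγ l).add (hb γ hγ l)
  zero_mem' := by
    intro γ _ l
    simp only [map_zero]
    exact isBigO_zero (E' := ℂ) (fun _ : ℝ => (1 : ℝ)) Filter.atTop
  smul_mem' := by
    intro c a ha γ hγ l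
    simpa using (ha γ hγ l).const_mul_left c

variable [FiniteDimensional ℂ W]

/-- The derivative `𝔤 → End W` of a holomorphic representation; it is characterised by
`l (r.deriv ξ w) = d/dg|₁ l (r(g) w)` in the direction `ξ`, for all functionals `l`. -/
def deriv (r : HolRep E G W) : LieAlg E G →ₗ[ℂ] W →ₗ[ℂ] W :=
  LinearMap.mk₂ ℂ (fun ξ w => (Module.evalEquiv ℂ W).symm
      { toFun := fun l => r.coeffDeriv ξ l w
        map_add' := fun l l' => r.coeffDeriv_add_left ξ l l' w
        map_smul' := fun c l => r.coeffDeriv_smul_left ξ c l w })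
    (by
      intro ξ ξ' w
      rw [← map_add]; congr 1; ext l
      exact map_add (mfderiv 𝓘(ℂ, E) 𝓘(ℂ) (fun g : G => l (r.rep g w)) 1) ξ ξ')
    (by
      intro c ξ w
      rw [← map_smul]; congr 1; ext l
      exact map_smul (mfderiv 𝓘(ℂ, E) 𝓘(ℂ) (fun g : G => l (r.rep g w)) 1) c ξ)
    (by
      intro ξ w w'
      rw [← map_add]; congr 1; ext l
      exact r.coeffDeriv_add_right ξ l w w')
    (by
      intro c ξ w
      rw [← map_smul]; congr 1; ext l
      exact r.coeffDeriv_smul_right ξ c l w)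

lemma apply_deriv (r : HolRep E G W) (l : Module.Dual ℂ W) (ξ : LieAlg E G) (w : W) :
    l (r.deriv ξ w) = r.coeffDeriv ξ l w :=
  Module.apply_evalEquiv_symm_apply (R := ℂ) (M := W) l _

end HolRep

end Rep

/-! ### The adjoint representation -/

section Adjoint

variable (E : Type*) [NormedAddCommGroup E] [NormedSpace ℂ E]
  (G : Type*) [TopologicalSpace G] [ChartedSpace E G] [Group G] [LieGroup 𝓘(ℂ, E) ω G]

variable {G} in
lemma contMDiff_conj (g : G) : ContMDiff 𝓘(ℂ, E) 𝓘(ℂ, E) ω (fun h : G => g * h * g⁻¹) :=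
  (contMDiff_mul_right (I := 𝓘(ℂ, E)) (a := g⁻¹)).comp (contMDiff_mul_left (a := g))

variable {G} in
lemma hasMFDerivAt_conj (g : G) :
    HasMFDerivAt 𝓘(ℂ, E) 𝓘(ℂ, E) (fun h : G => g * h * g⁻¹) 1
      (mfderiv 𝓘(ℂ, E) 𝓘(ℂ, E) (fun h : G => g * h * g⁻¹) 1) :=
  (((contMDiff_conj E g).mdifferentiable (by simp)) 1).hasMFDerivAt

/-- chain rule for a function precomposed with a conjugation -/
lemma mfderiv_comp_conj {f : G → ℂ} (hf : MDifferentiableAt 𝓘(ℂ, E) 𝓘(ℂ) f 1) (g : G)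
    (ξ : LieAlg E G) :
    mfderiv 𝓘(ℂ, E) 𝓘(ℂ) (fun h : G => f (g * h * g⁻¹)) 1 ξ =
      mfderiv 𝓘(ℂ, E) 𝓘(ℂ) f 1 (adMap E g ξ) := by
  have h1 : HasMFDerivAt 𝓘(ℂ, E) 𝓘(ℂ) f (g * 1 * g⁻¹) (mfderiv 𝓘(ℂ, E) 𝓘(ℂ) f 1) := by
    have key : ∀ a : G, a = 1 → HasMFDerivAt 𝓘(ℂ, E) 𝓘(ℂ) f a (mfderiv 𝓘(ℂ, E) 𝓘(ℂ) f 1) := by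
      rintro _ rfl
      exact hf.hasMFDerivAt
    exact key _ (by simp)
  have h2 := (h1.comp 1 (hasMFDerivAt_conj E g)).mfderiv
  exact congrArg (fun f => f ξ) h2

lemma adMap_mul (g g' : G) (ξ : LieAlg E G) :
    adMap E (g * g') ξ = adMap E g (adMap E g' ξ) := by
  have h1 : HasMFDerivAt 𝓘(ℂ, E) 𝓘(ℂ, E) (fun h : G => g * h * g⁻¹) (g' * 1 * g'⁻¹)
      (mfderiv 𝓘(ℂ, E) 𝓘(ℂ, E) (fun h : G => g * h * g⁻¹) 1) := by
    have key : ∀ a : G, a = 1 → HasMFDerivAt 𝓘(ℂ, E) 𝓘(ℂ, E) (fun h : G => g * h * g⁻¹) a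
        (mfderiv 𝓘(ℂ, E) 𝓘(ℂ, E) (fun h : G => g * h * g⁻¹) 1) := by
      rintro _ rfl
      exact hasMFDerivAt_conj E g
    exact key _ (by simp)
  have h2 := (h1.comp 1 (hasMFDerivAt_conj E g')).mfderiv
  have h3 : (fun h : G => g * h * g⁻¹) ∘ (fun h : G => g' * h * g'⁻¹) =
      (fun h : G => (g * g') * h * (g * g')⁻¹) := by
    ext h; simp [mul_assoc]
  rw [h3] at h2
  exact congrArg (fun f => f ξ) h2

lemma adMap_one (ξ : LieAlg E G) : adMap E (1 : G) ξ = ξ := by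
  have h3 : (fun h : G => 1 * h * (1 : G)⁻¹) = id := by ext h; simp
  unfold adMap
  rw [h3]
  exact congrArg (fun f => f ξ) (mfderiv_id (I := 𝓘(ℂ, E)) (x := (1 : G)))

variable [FiniteDimensional ℂ E]

/-- The adjoint representation `Ad : G → GL(𝔤)`. -/
def adRep : HolRep E G (LieAlg E G) where
  rep :=
    { toFun := adMap E
      map_one' := by ext ξ; exact adMap_one E G ξ
      map_mul' := fun g g' => by ext ξ; exact adMap_mul E G g g' ξ }
  holomorphic := by
    intro l ξ
    have hA : ContMDiff (𝓘(ℂ, E).prod 𝓘(ℂ, E)) 𝓘(ℂ, E) ω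
        (Function.uncurry fun g h : G => g * h * g⁻¹) :=
      (contMDiff_fst.mul contMDiff_snd).mul contMDiff_fst.inv
    intro g₀
    have h1 := ContMDiffAt.mfderiv (I := 𝓘(ℂ, E)) (I' := 𝓘(ℂ, E)) (m := ω) (n := ω) (x₀ := g₀)
      (fun g h : G => g * h * g⁻¹) (fun _ => 1) (hA _) contMDiffAt_const le_top
    let D : G → E →L[ℂ] E := fun g => by
      exact mfderiv 𝓘(ℂ, E) 𝓘(ℂ, E) (fun h : G => g * h * g⁻¹) 1
    have h2 : ContMDiffAt 𝓘(ℂ, E) 𝓘(ℂ, E →L[ℂ] E) ω D g₀ := by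
      refine h1.congr_of_eventuallyEq (Filter.Eventually.of_forall fun g => ?_)
      have hg : ∀ a : G, a * 1 * a⁻¹ = 1 := by simp
      have key : ∀ a b : G, a = 1 → b = 1 → ∀ v : E,
          (tangentBundleCore 𝓘(ℂ, E) G).coordChange (achart E a) (achart E b) a v = v := by
        rintro _ _ rfl rfl v
        exact (tangentBundleCore 𝓘(ℂ, E) G).coordChange_self _ _ (mem_chart_source E _) v
      have hs : g * 1 * g⁻¹ ∈ (chartAt E (g₀ * 1 * g₀⁻¹)).source := by
        simp only [hg]
        exact mem_chart_source E _
      refine Eq.trans ?_ (inTangentCoordinates_eq (I := 𝓘(ℂ, E)) (I' := 𝓘(ℂ, E)) (fun _ : G => (1 : G))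
        (fun x : G => x * 1 * x⁻¹) D (x₀ := g₀) (x := g) (mem_chart_source E _) hs).symm
      ext v
      have e1 := key _ _ (hg g) (hg g₀) (D g v)
      have e2 := key 1 1 rfl rfl v
      refine e1.symm.trans ?_
      exact congrArg (fun w => (tangentBundleCore 𝓘(ℂ, E) G).coordChange (achart E (g * 1 * g⁻¹))
        (achart E (g₀ * 1 * g₀⁻¹)) (g * 1 * g⁻¹) (D g w)) e2.symm
    let l' : E →L[ℂ] ℂ := LinearMap.toContinuousLinearMap (by exact l)
    exact (l'.contDiff.contMDiff.contMDiffAt).comp g₀ (h2.clm_apply contMDiffAt_const)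

end Adjoint

/-! ### Symplectic representations and moment maps -/

section Symplectic

variable (E : Type*) [NormedAddCommGroup E] [NormedSpace ℂ E] [FiniteDimensional ℂ E]
  (G : Type*) [TopologicalSpace G] [ChartedSpace E G] [Group G] [LieGroup 𝓘(ℂ, E) ω G]
  (V : Type*) [AddCommGroup V] [Module ℂ V] [FiniteDimensional ℂ V]

/-- A symplectic representation `ρ : G → Sp(V, ω)`. -/
structure SymplecticRep extends HolRep E G V where
  form : LinearMap.BilinForm ℂ V
  alternating : form.IsAlt
  nondegenerate : form.Nondegenerate
  invariant : ∀ (g : G) (v w : V), form (rep g v) (rep g w) = form v w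

/-- A non-degenerate `Ad`-invariant bilinear form on `𝔤`. -/
structure InvariantForm where
  form : LinearMap.BilinForm ℂ (LieAlg E G)
  nondegenerate : form.Nondegenerate
  invariant : ∀ (g : G) (ξ η : LieAlg E G), form (adMap E g ξ) (adMap E g η) = form ξ η

variable {E G V}

/-- The polarised moment map with values in `𝔤*`: `(v, w) ↦ (ξ ↦ ½ ω(ρ(ξ) v, w))`. -/
def momentBilinDual (ρ : SymplecticRep E G V) : V →ₗ[ℂ] V →ₗ[ℂ] Module.Dual ℂ (LieAlg E G) :=
  LinearMap.mk₂ ℂ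
    (fun v w => (1 / 2 : ℂ) • ((ρ.form.flip w) ∘ₗ (ρ.toHolRep.deriv.flip v)))
    (by intros; ext; simp [mul_add]) (by intros; ext; simp [mul_left_comm])
    (by intros; ext; simp [mul_add]) (by intros; ext; simp [mul_left_comm])

/-- The polarised moment map with values in `𝔤`, identified with `𝔤*` through `B`. -/
def momentBilin (ρ : SymplecticRep E G V) (B : InvariantForm E G) :
    V →ₗ[ℂ] V →ₗ[ℂ] LieAlg E G :=
  (momentBilinDual ρ).compr₂ (B.form.toDual B.nondegenerate).symm.toLinearMap

/-- The quadratic moment map `μ : V → 𝔤`. -/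
def momentMap (ρ : SymplecticRep E G V) (B : InvariantForm E G) (v : V) : LieAlg E G :=
  momentBilin ρ B v v

lemma form_momentBilin (ρ : SymplecticRep E G V) (B : InvariantForm E G) (v w : V)
    (ξ : LieAlg E G) :
    B.form (momentBilin ρ B v w) ξ = (1 / 2 : ℂ) * ρ.form (ρ.toHolRep.deriv ξ v) w := by
  simp only [momentBilin, LinearMap.compr₂_apply, LinearEquiv.coe_coe,
    LinearMap.BilinForm.apply_toDual_symm_apply]
  simp [momentBilinDual]

/-- The defining property of the moment map. -/
lemma form_momentMap (ρ : SymplecticRep E G V) (B : InvariantForm E G) (v : V) (ξ : LieAlg E G) :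
    B.form (momentMap ρ B v) ξ = (1 / 2 : ℂ) * ρ.form (ρ.toHolRep.deriv ξ v) v :=
  form_momentBilin ρ B v v ξ

lemma deriv_adMap (ρ : HolRep E G V) (g : G) (ξ : LieAlg E G) (v : V) :
    ρ.deriv (adMap E g ξ) v = ρ.rep g (ρ.deriv ξ (ρ.rep g⁻¹ v)) := by
  rw [← sub_eq_zero]
  refine (Module.forall_dual_apply_eq_zero_iff ℂ _).1 fun l => ?_
  rw [map_sub, sub_eq_zero]
  change _ = (l ∘ₗ ρ.rep g) _
  rw [HolRep.apply_deriv, HolRep.apply_deriv]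
  have h := mfderiv_comp_conj E G (ρ.mdifferentiableAt l v 1) g ξ
  refine h.symm.trans ?_
  have h2 : (fun h : G => l (ρ.rep (g * h * g⁻¹) v)) =
      (fun h : G => (l ∘ₗ ρ.rep g) (ρ.rep h (ρ.rep g⁻¹ v))) := by
    ext h; simp [map_mul]
  unfold HolRep.coeffDeriv
  rw [h2]
  rfl

/-- The moment map is equivariant. -/
lemma momentBilin_rep (ρ : SymplecticRep E G V) (B : InvariantForm E G) (g : G) (v w : V) :
    momentBilin ρ B (ρ.rep g v) (ρ.rep g w) = adMap E g (momentBilin ρ B v w) := by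
  apply (B.form.toDual B.nondegenerate).injective
  ext ξ
  have e : ξ = adMap E g (adMap E g⁻¹ ξ) := by
    rw [← adMap_mul]; simp [adMap_one]
  rw [LinearMap.BilinForm.toDual_def, LinearMap.BilinForm.toDual_def, form_momentBilin]
  conv_rhs => rw [e]
  rw [B.invariant, form_momentBilin]
  congr 1
  rw [deriv_adMap, inv_inv]
  conv_rhs => rw [← ρ.invariant g]
  simp

end Symplectic

/-! ### Riemann surfaces, principal bundles, twisted sections -/

section Bundles

variable {X : Type*} [TopologicalSpace X] [ChartedSpace ℂ X]

/-- The (fibres of the) canonical line bundle `K`: the dual of the holomorphic tangent bundle. -/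
abbrev Canonical (X : Type*) [TopologicalSpace X] [ChartedSpace ℂ X] (x : X) : Type :=
  TangentSpace 𝓘(ℂ) x →L[ℂ] Trivial X ℂ x

/-- `e` is a holomorphic section over the set `U` of the holomorphic vector bundle `L`
with model fibre `F`. -/
def IsHolSection (F : Type*) [NormedAddCommGroup F] [NormedSpace ℂ F] {L : X → Type*}
    [∀ x, AddCommGroup (L x)] [∀ x, Module ℂ (L x)] [∀ x, TopologicalSpace (L x)]
    [TopologicalSpace (TotalSpace F L)] [FiberBundle F L]
    (U : Set X) (e : ∀ x, L x) : Prop :=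
  ContMDiffOn 𝓘(ℂ) (𝓘(ℂ).prod 𝓘(ℂ, F)) ω (fun x => TotalSpace.mk' F x (e x)) U

/-- A square root of the canonical bundle: the holomorphic line bundle `S` together with an
isomorphism `S ⊗ S ≅ K`, given as a holomorphic, fibrewise bilinear and nonvanishing pairing. -/
structure CanonicalSqrt [IsManifold 𝓘(ℂ) ω X] (S : X → Type*)
    [∀ x, AddCommGroup (S x)] [∀ x, Module ℂ (S x)] [∀ x, TopologicalSpace (S x)]
    [TopologicalSpace (TotalSpace ℂ S)] [FiberBundle ℂ S] where
  sq : ∀ x, S x →ₗ[ℂ] S x →ₗ[ℂ] Canonical X x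
  holomorphic : ∀ (U : Set X) (e e' : ∀ x, S x), IsOpen U → IsHolSection ℂ U e →
    IsHolSection ℂ U e' → IsHolSection (ℂ →L[ℂ] ℂ) U (fun x => sq x (e x) (e' x))
  nonvanishing : ∀ x (s : S x), s ≠ 0 → sq x s s ≠ 0

variable (E : Type*) [NormedAddCommGroup E] [NormedSpace ℂ E]
  {G : Type*} [TopologicalSpace G] [ChartedSpace E G] [Group G]
  (EP : Type*) [NormedAddCommGroup EP] [NormedSpace ℂ EP]
  {P : Type*} [TopologicalSpace P] [ChartedSpace EP P] [MulAction Gᵐᵒᵖ P]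

/-- `pr : P → X` is a holomorphic principal `G`-bundle. The right action of `g` on `p` is
`MulOpposite.op g • p`. -/
structure IsPrincipalBundle (G : Type*) [TopologicalSpace G] [ChartedSpace E G] [Group G]
    {P : Type*} [TopologicalSpace P] [ChartedSpace EP P] [MulAction Gᵐᵒᵖ P]
    (pr : P → X) : Prop where
  proj_smul : ∀ (g : G) (p : P), pr (MulOpposite.op g • p) = pr p
  locallyTrivial : ∀ x : X, ∃ e : Trivialization G pr, x ∈ e.baseSet ∧
    ContMDiffOn 𝓘(ℂ, EP) (𝓘(ℂ).prod 𝓘(ℂ, E)) ω e e.source ∧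
    ContMDiffOn (𝓘(ℂ).prod 𝓘(ℂ, E)) 𝓘(ℂ, EP) ω e.toOpenPartialHomeomorph.symm e.target ∧
    ∀ p ∈ e.source, ∀ g : G, (e (MulOpposite.op g • p)).2 = (e p).2 * g

/-- `s` is a holomorphic section of `P` over the open set `U`. -/
structure IsLocalSection (pr : P → X) (U : Set X) (s : X → P) : Prop where
  isOpen : IsOpen U
  holomorphic : ContMDiffOn 𝓘(ℂ) 𝓘(ℂ, EP) ω s U
  proj : ∀ y ∈ U, pr (s y) = y

/-- A global holomorphic section of `P(W) ⊗ L`, where `P(W)` is the vector bundle associated to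
`P` via the representation `r` of `G` on `W`, and `L` is a line bundle with model fibre `F`.
It is given as the corresponding `G`-equivariant map, which sends `p ∈ P` over `x` to an element of
`W ⊗ L x`; holomorphy is tested in local holomorphic frames of `P`. -/
@[ext]
structure TwistedSection {W : Type*} [AddCommGroup W] [Module ℂ W] (r : HolRep E G W) (pr : P → X)
    (F : Type*) [NormedAddCommGroup F] [NormedSpace ℂ F] (L : X → Type*)
    [∀ x, AddCommGroup (L x)] [∀ x, Module ℂ (L x)] [∀ x, TopologicalSpace (L x)]
    [TopologicalSpace (TotalSpace F L)] [FiberBundle F L] where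
  toFun : ∀ (x : X) (p : P), pr p = x → W ⊗[ℂ] L x
  equivariant : ∀ (x : X) (p : P) (g : G) (h : pr p = x) (h' : pr (MulOpposite.op g • p) = x),
    toFun x (MulOpposite.op g • p) h' =
      TensorProduct.map (r.rep g⁻¹) LinearMap.id (toFun x p h)
  holomorphic : ∀ x : X, ∃ (U : Set X) (s : X → P) (v : X → W) (e : ∀ y, L y), x ∈ U ∧
    IsLocalSection EP pr U s ∧
    (∀ l : Module.Dual ℂ W, ContMDiffOn 𝓘(ℂ) 𝓘(ℂ) ω (fun y => l (v y)) U) ∧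
    IsHolSection F U e ∧
    ∀ y ∈ U, ∀ h : pr (s y) = y, toFun y (s y) h = v y ⊗ₜ[ℂ] e y

/-- The Higgs field `μ(ψ)`, a section of `Ad(P) ⊗ K`, attached to a section `ψ` of
`P(V) ⊗ K^{1/2}`: on fibres it is the quadratic map `v ⊗ s ↦ μ(v) ⊗ s²`
from `V ⊗ K^{1/2}` to `𝔤 ⊗ K`. -/
def higgsField [FiniteDimensional ℂ E] [LieGroup 𝓘(ℂ, E) ω G] [IsManifold 𝓘(ℂ) ω X]
    {V : Type*} [AddCommGroup V] [Module ℂ V] [FiniteDimensional ℂ V]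
    (ρ : SymplecticRep E G V) (B : InvariantForm E G) {pr : P → X}
    {S : X → Type*}
    [∀ x, AddCommGroup (S x)] [∀ x, Module ℂ (S x)] [∀ x, TopologicalSpace (S x)]
    [TopologicalSpace (TotalSpace ℂ S)] [FiberBundle ℂ S] (κ : CanonicalSqrt S)
    (ψ : TwistedSection E EP ρ.toHolRep pr ℂ S) :
    TwistedSection E EP (adRep E G) pr (ℂ →L[ℂ] ℂ) (Canonical X) where
  toFun x p h := TensorProduct.map₂ (momentBilin ρ B) (κ.sq x) (ψ.toFun x p h) (ψ.toFun x p h)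
  equivariant := by
    intro x p g h h'
    rw [ψ.equivariant x p g h h']
    generalize ψ.toFun x p h = t
    have key : ∀ t t' : V ⊗[ℂ] S x,
        TensorProduct.map₂ (momentBilin ρ B) (κ.sq x)
          (TensorProduct.map (ρ.rep g⁻¹) LinearMap.id t)
          (TensorProduct.map (ρ.rep g⁻¹) LinearMap.id t') =
        TensorProduct.map ((adRep E G).rep g⁻¹) LinearMap.id
          (TensorProduct.map₂ (momentBilin ρ B) (κ.sq x) t t') := by
      intro t t'
      induction t with
      | zero => simp
      | add a b ha hb => simp only [map_add, LinearMap.add_apply, ha, hb]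
      | tmul v s =>
        induction t' with
        | zero => simp
        | add a b ha hb => simp only [map_add, ha, hb]
        | tmul w s' =>
          simp only [TensorProduct.map_tmul, TensorProduct.map₂_apply_tmul, momentBilin_rep]
          rfl
    exact key t t
  holomorphic := by
    intro x
    obtain ⟨U, s, v, e, hx, hs, hv, he, h⟩ := ψ.holomorphic x
    refine ⟨U, s, fun y => momentMap ρ B (v y), fun y => κ.sq y (e y) (e y), hx, hs, ?_,
      κ.holomorphic U e e hs.isOpen he he, ?_⟩
    · intro l
      let b := Module.finBasis ℂ V
      have hq : ∀ y, l (momentMap ρ B (v y)) =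
          ∑ i, ∑ j, b.coord i (v y) * b.coord j (v y) * l (momentBilin ρ B (b j) (b i)) := by
        intro y
        have hc : ∀ c : Fin (Module.finrank ℂ V) → ℂ,
            l (momentBilin ρ B (∑ i, c i • b i) (∑ j, c j • b j)) =
              ∑ i, ∑ j, c i * c j * l (momentBilin ρ B (b j) (b i)) := by
          intro c
          simp [map_sum, LinearMap.sum_apply, Finset.mul_sum, mul_assoc]
        have := hc (fun i => b.coord i (v y))
        simp only [Module.Basis.coord_apply, b.sum_repr] at this
        exact this
      simp only [hq]
      refine contMDiffOn_finsetSum fun i _ => contMDiffOn_finsetSum fun j _ => ?_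
      exact ((hv _).mul (hv _)).mul contMDiffOn_const
    · intro y hy hp
      simp only [h y hy hp, TensorProduct.map₂_apply_tmul]
      rfl

end Bundles

/-! ### Parabolic subgroups and anti-dominant characters -/

section Parabolic

variable {E : Type*} [NormedAddCommGroup E] [NormedSpace ℂ E] [FiniteDimensional ℂ E]
  [CompleteSpace E]
  {G : Type*} [TopologicalSpace G] [ChartedSpace E G] [Group G] [LieGroup 𝓘(ℂ, E) ω G]

/-- A parabolic subalgebra of `𝔤`: one that contains a Borel (i.e. maximal solvable) subalgebra. -/
def IsParabolic (𝔮 : LieSubalgebra ℂ (LieAlg E G)) : Prop :=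
  ∃ 𝔟 : LieSubalgebra ℂ (LieAlg E G),
    Maximal (fun 𝔞 : LieSubalgebra ℂ (LieAlg E G) => LieAlgebra.IsSolvable 𝔞) 𝔟 ∧ 𝔟 ≤ 𝔮

/-- The normaliser `{g | Ad(g) 𝔮 = 𝔮}` of `𝔮` in `G`. When `𝔮` runs through the parabolic
subalgebras, this runs through the parabolic subgroups `Q` of `G`, and `𝔮` is the Lie algebra
of `Q`. -/
def normalizer (𝔮 : LieSubalgebra ℂ (LieAlg E G)) : Subgroup G where
  carrier := {g | ∀ ξ, adMap E g ξ ∈ 𝔮 ↔ ξ ∈ 𝔮}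
  mul_mem' := by
    intro a b ha hb ξ
    rw [adMap_mul, ha, hb]
  one_mem' := by
    intro ξ
    rw [adMap_one]
  inv_mem' := by
    intro a ha ξ
    rw [← ha, ← adMap_mul, mul_inv_cancel, adMap_one]

/-- The nilradical of a finite-dimensional Lie algebra: its largest nilpotent ideal. -/
def nilradical (𝔞 : Type*) [LieRing 𝔞] [LieAlgebra ℂ 𝔞] : LieIdeal ℂ 𝔞 :=
  sSup {I : LieIdeal ℂ 𝔞 | LieRing.IsNilpotent I}

/-- `𝔩` is (the Lie algebra of) a Levi subgroup of the parabolic with Lie algebra `𝔮`: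
a subalgebra of `𝔮` complementary to the nilradical. -/
def IsLevi {𝔮 : LieSubalgebra ℂ (LieAlg E G)} (𝔩 : LieSubalgebra ℂ 𝔮) : Prop :=
  IsCompl 𝔩.toSubmodule (nilradical 𝔮).toSubmodule

open scoped Classical in
/-- The function on `G` which is `χ` on the subgroup `Q` (and `0` elsewhere). -/
def extendChar {Q : Subgroup G} (χ : Q →* ℂˣ) (g : G) : ℂ :=
  if h : g ∈ Q then (χ ⟨g, h⟩ : ℂ) else 0

/-- `χ` is a holomorphic character of `Q`: near each point of `Q` it is the restriction to `Q` of
a holomorphic function on an open subset of `G`. -/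
def IsHolChar {Q : Subgroup G} (χ : Q →* ℂˣ) : Prop :=
  ContMDiffOn 𝓘(ℂ, E) 𝓘(ℂ) ω (extendChar χ) (Q : Set G)

/-- `dχ : 𝔮 → ℂ` is the differential at `1` of the character `χ` of `Q = normalizer 𝔮`. -/
def IsDifferential {𝔮 : LieSubalgebra ℂ (LieAlg E G)} (χ : normalizer 𝔮 →* ℂˣ)
    (dχ : 𝔮 →ₗ[ℂ] ℂ) : Prop :=
  ∃ l : LieAlg E G →L[ℂ] ℂ,
    HasMFDerivWithinAt 𝓘(ℂ, E) 𝓘(ℂ) (extendChar χ) (normalizer 𝔮 : Set G) 1 l ∧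
      ∀ ξ : 𝔮, dχ ξ = l ξ

/-- The differential `dχ` of a character is anti-dominant: its value on the coroot `h_α` is `≤ 0`
for every root `α` whose root space lies in `𝔮`, relative to Cartan subalgebras `𝔱 ⊆ 𝔮` of `𝔤`. -/
def IsAntidominantWeight [LieAlgebra.IsSemisimple ℂ (LieAlg E G)]
    {𝔮 : LieSubalgebra ℂ (LieAlg E G)} (dχ : 𝔮 →ₗ[ℂ] ℂ) : Prop :=
  ∀ (𝔱 : LieSubalgebra ℂ (LieAlg E G)) [𝔱.IsCartanSubalgebra] (h𝔱 : 𝔱 ≤ 𝔮)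
    (α : LieModule.Weight ℂ 𝔱 (LieAlg E G)), α.IsNonZero →
    (∀ ξ ∈ LieAlgebra.rootSpace 𝔱 α, ξ ∈ 𝔮) →
    (dχ ⟨LieAlgebra.IsKilling.coroot α, h𝔱 (LieAlgebra.IsKilling.coroot α).2⟩).re ≤ 0

/-- An anti-dominant character `χ : Q → ℂˣ` of the parabolic subgroup `Q = normalizer 𝔮`, with
differential `dχ`. -/
structure IsAntidominant [LieAlgebra.IsSemisimple ℂ (LieAlg E G)]
    {𝔮 : LieSubalgebra ℂ (LieAlg E G)} (χ : normalizer 𝔮 →* ℂˣ) (dχ : 𝔮 →ₗ[ℂ] ℂ) : Prop where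
  holomorphic : IsHolChar (E := E) χ
  differential : IsDifferential χ dχ
  trivial_on_center : ∀ z ∈ Subgroup.center (normalizer 𝔮), χ z = 1
  antidominant : IsAntidominantWeight dχ

/-- `s = s_χ`: the element of the centre of the Levi subalgebra `𝔩` of `𝔮` which corresponds, under
the Killing form of `𝔤`, to the restriction of `dχ` to the centre of `𝔩`. -/
structure IsDualElement {𝔮 : LieSubalgebra ℂ (LieAlg E G)} (𝔩 : LieSubalgebra ℂ 𝔮)
    (dχ : 𝔮 →ₗ[ℂ] ℂ) (s : 𝔮) : Prop where
  mem : s ∈ 𝔩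
  central : ∀ y ∈ 𝔩, ⁅s, y⁆ = 0
  dual : ∀ z ∈ 𝔩, (∀ y ∈ 𝔩, ⁅z, y⁆ = 0) →
    killingForm ℂ (LieAlg E G) (s : LieAlg E G) (z : LieAlg E G) = dχ z

end Parabolic

/-! ### Reductions of structure group, degrees and stability -/

section Stability

variable {X : Type*} [TopologicalSpace X] [ChartedSpace ℂ X]
  {E : Type*} [NormedAddCommGroup E] [NormedSpace ℂ E]
  {G : Type*} [TopologicalSpace G] [ChartedSpace E G] [Group G]
  {EP : Type*} [NormedAddCommGroup EP] [NormedSpace ℂ EP]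
  {P : Type*} [TopologicalSpace P] [ChartedSpace EP P] [MulAction Gᵐᵒᵖ P]

variable (EP) in
/-- A holomorphic reduction of the structure group of `P` to `Q`, i.e. a holomorphic section of
`P/Q`, given as the corresponding principal `Q`-subbundle `P_σ ⊆ P`. -/
structure Reduction (pr : P → X) (Q : Subgroup G) where
  carrier : Set P
  smul_mem : ∀ p ∈ carrier, ∀ g ∈ Q, MulOpposite.op g • p ∈ carrier
  transitive : ∀ p ∈ carrier, ∀ p' ∈ carrier, pr p = pr p' → ∃ g ∈ Q, p' = MulOpposite.op g • p
  exists_section : ∀ x : X, ∃ (U : Set X) (s : X → P), x ∈ U ∧ IsLocalSection EP pr U s ∧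
    ∀ y ∈ U, s y ∈ carrier

/-- `f` is a meromorphic section, with order of vanishing `n x` at each `x`, of the line bundle
`P_σ ×_χ ℂ` associated to the reduction `σ` via the character `χ`: it is given as a
`Q`-equivariant function on `P_σ`, and read in local holomorphic sections of `P_σ`. -/
structure IsMeromorphicSection {pr : P → X} {Q : Subgroup G} (σ : Reduction EP pr Q)
    (χ : Q →* ℂˣ) (f : P → ℂ) (n : X → ℤ) : Prop where
  equivariant : ∀ p ∈ σ.carrier, ∀ q : Q,
    f (MulOpposite.op (q : G) • p) = ((χ q)⁻¹ : ℂˣ) * f p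
  meromorphic : ∀ (U : Set X) (s : X → P), IsLocalSection EP pr U s →
    (∀ y ∈ U, s y ∈ σ.carrier) → ∀ x ∈ U,
      MeromorphicAt (fun z => f (s ((chartAt ℂ x).symm z))) (chartAt ℂ x x)
  order : ∀ (U : Set X) (s : X → P), IsLocalSection EP pr U s →
    (∀ y ∈ U, s y ∈ σ.carrier) → ∀ x ∈ U,
      meromorphicOrderAt (fun z => f (s ((chartAt ℂ x).symm z))) (chartAt ℂ x x) = n x
  finite_support : (Function.support n).Finite

/-- The degree `deg(P)(σ, χ)` of the line bundle `P_σ ×_χ ℂ` over the compact Riemann surface `X`: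
the number of zeros minus the number of poles, with multiplicity, of any meromorphic section
that is not identically zero. -/
def degree {pr : P → X} {Q : Subgroup G} (σ : Reduction EP pr Q) (χ : Q →* ℂˣ) : ℤ :=
  Classical.epsilon fun d => ∃ (f : P → ℂ) (n : X → ℤ),
    IsMeromorphicSection σ χ f n ∧ d = ∑ᶠ x, n x

variable {W : Type*} [AddCommGroup W] [Module ℂ W] {r : HolRep E G W} {pr : P → X}
  {F : Type*} [NormedAddCommGroup F] [NormedSpace ℂ F] {L : X → Type*}
  [∀ x, AddCommGroup (L x)] [∀ x, Module ℂ (L x)] [∀ x, TopologicalSpace (L x)]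
  [TopologicalSpace (TotalSpace F L)] [FiberBundle F L]

/-- The section `φ` of `P(W) ⊗ L` is a section of the subbundle `(P_σ ×_Q W_s⁻) ⊗ L`. -/
def TwistedSection.LiesIn (φ : TwistedSection E EP r pr F L) {Q : Subgroup G}
    (σ : Reduction EP pr Q) (s : LieAlg E G) : Prop :=
  ∀ (x : X) (p : P) (h : pr p = x), p ∈ σ.carrier →
    φ.toFun x p h ∈ LinearMap.range
      (TensorProduct.map (r.boundedSubspace s).subtype (LinearMap.id : L x →ₗ[ℂ] L x))

variable [FiniteDimensional ℂ E] [CompleteSpace E] [LieGroup 𝓘(ℂ, E) ω G]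
  [LieAlgebra.IsSemisimple ℂ (LieAlg E G)]

/-- Semistability of the twisted pair `(P, φ)`. -/
def IsSemistable (φ : TwistedSection E EP r pr F L) : Prop :=
  ∀ (𝔮 : LieSubalgebra ℂ (LieAlg E G)), IsParabolic 𝔮 →
  ∀ (σ : Reduction EP pr (normalizer 𝔮)) (χ : normalizer 𝔮 →* ℂˣ) (dχ : 𝔮 →ₗ[ℂ] ℂ),
    χ ≠ 1 → IsAntidominant χ dχ →
  ∀ (𝔩 : LieSubalgebra ℂ 𝔮) (s : 𝔮), IsLevi 𝔩 → IsDualElement 𝔩 dχ s →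
    φ.LiesIn σ (s : LieAlg E G) → 0 ≤ degree σ χ

/-- Stability of the twisted pair `(P, φ)`. -/
def IsStable (φ : TwistedSection E EP r pr F L) : Prop :=
  ∀ (𝔮 : LieSubalgebra ℂ (LieAlg E G)), IsParabolic 𝔮 → normalizer 𝔮 ≠ ⊤ →
  ∀ (σ : Reduction EP pr (normalizer 𝔮)) (χ : normalizer 𝔮 →* ℂˣ) (dχ : 𝔮 →ₗ[ℂ] ℂ),
    χ ≠ 1 → IsAntidominant χ dχ →
  ∀ (𝔩 : LieSubalgebra ℂ 𝔮) (s : 𝔮), IsLevi 𝔩 → IsDualElement 𝔩 dχ s →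
    φ.LiesIn σ (s : LieAlg E G) → 0 < degree σ χ

end Stability

end HiggsPair

end

open Bundle HiggsPair
open scoped Manifold ContDiff

section BoundedSubspace

variable {E : Type*} [NormedAddCommGroup E] [NormedSpace ℂ E] [FiniteDimensional ℂ E]
  {G : Type*} [TopologicalSpace G] [ChartedSpace E G] [Group G] [LieGroup 𝓘(ℂ, E) ω G]
  {V : Type*} [AddCommGroup V] [Module ℂ V] [FiniteDimensional ℂ V]

/-! Fix a parabolic, a reduction `σ`, an anti-dominant character `χ` and its dual element `s`. The
section enters the (semi)stability test only through the condition that it lies in the subbundle cut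
out by the vectors that stay bounded under `exp (t s)`; the number tested, `degree σ χ`, does not
see the section at all. So it is enough that every choice of data admissible for `ψ` is also
admissible for `μ(ψ)`: the Higgs field is then tested against at least as many inequalities as `ψ`,
and each inequality required of `ψ` is one already known for `μ(ψ)`.

The inclusion follows from equivariance. Since `Ad(exp (t s)) μ(v) = μ(exp (t s) v)` and `μ` is
polynomial on a finite-dimensional space, a bounded orbit of `v` has a bounded image. For this to
pass to elements of `V ⊗ K^{1/2}`, which are treated as sums of pure tensors, the quadratic map is
replaced throughout by the bilinear map `momentBilin`. `momentBilin_mem_boundedSubspace` is the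
pointwise statement for two bounded vectors, and `TwistedSection.LiesIn.higgsField` is its version
for sections. -/

/-- The moment map sends vectors bounded under `exp (t s)` to vectors bounded under
`Ad (exp (t s))`. -/
lemma HiggsPair.momentBilin_mem_boundedSubspace (ρ : SymplecticRep E G V) (B : InvariantForm E G)
    (s : LieAlg E G) {v w : V} (hv : v ∈ ρ.toHolRep.boundedSubspace s)
    (hw : w ∈ ρ.toHolRep.boundedSubspace s) :
    momentBilin ρ B v w ∈ (adRep E G).boundedSubspace s := by
  intro γ hγ l
  -- Boundedness in `V` is known only through linear functionals, whereas `l ∘ μ` is bilinear. In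
  -- coordinates it becomes a finite sum of products of two coordinate functionals, each of which
  -- the hypotheses control.
  let b := Module.finBasis ℂ V
  have expand (v w : V) : l (momentBilin ρ B v w) =
      ∑ i, ∑ j, b.coord i v * b.coord j w * l (momentBilin ρ B (b i) (b j)) := by
    conv_lhs => rw [← b.sum_repr v, ← b.sum_repr w]
    simp only [map_sum, map_smul, LinearMap.sum_apply, LinearMap.smul_apply, smul_eq_mul,
      Module.Basis.coord_apply, Finset.mul_sum]
    rw [Finset.sum_comm]
    exact Finset.sum_congr rfl fun i _ => Finset.sum_congr rfl fun j _ => by ring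
  -- Equivariance moves `Ad (γ t)` inside the moment map, so all dependence on `t` now sits in the
  -- coordinates of the two orbits in `V`.
  have h (t : ℝ) : l ((adRep E G).rep (γ t) (momentBilin ρ B v w)) =
      ∑ i, ∑ j, b.coord i (ρ.rep (γ t) v) * b.coord j (ρ.rep (γ t) w) *
        l (momentBilin ρ B (b i) (b j)) := by
    rw [← expand, momentBilin_rep]
    rfl
  simp only [h]
  refine Asymptotics.IsBigO.fun_sum fun i _ => Asymptotics.IsBigO.fun_sum fun j _ => ?_
  -- The same `γ` serves for both orbits, so each term is a product of two `O(1)` functions and a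
  -- constant.
  have hij := (hv γ hγ (b.coord i)).mul (hw γ hγ (b.coord j))
  simpa using hij.mul (Asymptotics.isBigO_const_const (l (momentBilin ρ B (b i) (b j)))
    (one_ne_zero (α := ℝ)) Filter.atTop)

/-- If `ψ` is a section of `(P_σ ×_Q V_s⁻) ⊗ K^{1/2}`, then `μ(ψ)` is a section of
`(P_σ ×_Q 𝔤_s⁻) ⊗ K`. -/
lemma HiggsPair.TwistedSection.LiesIn.higgsField
    {X : Type*} [TopologicalSpace X] [ChartedSpace ℂ X] [IsManifold 𝓘(ℂ) ω X]
    {EP : Type*} [NormedAddCommGroup EP] [NormedSpace ℂ EP]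
    {P : Type*} [TopologicalSpace P] [ChartedSpace EP P] [MulAction Gᵐᵒᵖ P] {pr : P → X}
    {S : X → Type*} [∀ x, AddCommGroup (S x)] [∀ x, Module ℂ (S x)] [∀ x, TopologicalSpace (S x)]
    [TopologicalSpace (TotalSpace ℂ S)] [FiberBundle ℂ S]
    {ρ : SymplecticRep E G V} {ψ : TwistedSection E EP ρ.toHolRep pr ℂ S}
    {Q : Subgroup G} {σ : Reduction EP pr Q} {s : LieAlg E G} (h : ψ.LiesIn σ s)
    (B : InvariantForm E G) (κ : CanonicalSqrt S) :
    (HiggsPair.higgsField E EP ρ B κ ψ).LiesIn σ s := by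
  intro x p hp hmem
  change TensorProduct.map₂ (momentBilin ρ B) (κ.sq x) (ψ.toFun x p hp) (ψ.toFun x p hp) ∈ _
  obtain ⟨t, ht⟩ := h x p hp hmem
  rw [← ht]
  -- Induction on a tensor needs additivity, which the diagonal map `t ↦ μ(t, t)` lacks. With `t`
  -- and `t'` independent the expression is additive in each; the cross terms `μ(v, w)` with `v ≠ w`
  -- are the reason the pointwise lemma concerns two vectors.
  have key (t t' : ρ.toHolRep.boundedSubspace s ⊗[ℂ] S x) :
      TensorProduct.map₂ (momentBilin ρ B) (κ.sq x)
          (TensorProduct.map (ρ.toHolRep.boundedSubspace s).subtype LinearMap.id t)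
          (TensorProduct.map (ρ.toHolRep.boundedSubspace s).subtype LinearMap.id t') ∈
        LinearMap.range (TensorProduct.map ((adRep E G).boundedSubspace s).subtype
          (LinearMap.id : Canonical X x →ₗ[ℂ] Canonical X x)) := by
    induction t with
    | zero => simp
    | add a b ha hb =>
      simp only [map_add, LinearMap.add_apply]
      exact add_mem ha hb
    | tmul v e =>
      induction t' with
      | zero => simp
      | add a b ha hb =>
        simp only [map_add]
        exact add_mem ha hb
      | tmul w e' =>
        -- On pure tensors the preimage is explicit: `μ(v, w)`, regarded as an element of the
        -- bounded subspace of `𝔤`, tensored with the product of `e` and `e'` in `K`.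
        exact ⟨⟨momentBilin ρ B v w, momentBilin_mem_boundedSubspace ρ B s v.2 w.2⟩ ⊗ₜ
          κ.sq x e e', by simp⟩
  exact key t t

end BoundedSubspace

theorem mainTheorem12
    -- the compact Riemann surface `X`
    {X : Type*} [TopologicalSpace X] [T2Space X] [CompactSpace X] [ConnectedSpace X]
    [ChartedSpace ℂ X] [IsManifold 𝓘(ℂ) ω X]
    -- the connected complex semisimple Lie group `G`
    {E : Type*} [NormedAddCommGroup E] [NormedSpace ℂ E] [FiniteDimensional ℂ E] [CompleteSpace E]
    {G : Type*} [TopologicalSpace G] [ChartedSpace E G] [Group G] [LieGroup 𝓘(ℂ, E) ω G]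
    [ConnectedSpace G] [LieAlgebra.IsSemisimple ℂ (LieAlg E G)]
    -- the symplectic representation `ρ : G → Sp(V, ω)` and the invariant form on the Lie algebra
    {V : Type*} [AddCommGroup V] [Module ℂ V] [FiniteDimensional ℂ V]
    (ρ : SymplecticRep E G V) (B : InvariantForm E G)
    -- the holomorphic line bundle `S`, a square root of the canonical bundle
    {S : X → Type*} [∀ x, AddCommGroup (S x)] [∀ x, Module ℂ (S x)] [∀ x, TopologicalSpace (S x)]
    [TopologicalSpace (TotalSpace ℂ S)] [FiberBundle ℂ S] [VectorBundle ℂ ℂ S]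
    [ContMDiffVectorBundle ω ℂ S 𝓘(ℂ)] (κ : CanonicalSqrt S)
    -- the holomorphic principal `G`-bundle `pr : P → X`
    {EP : Type*} [NormedAddCommGroup EP] [NormedSpace ℂ EP]
    {P : Type*} [TopologicalSpace P] [ChartedSpace EP P] [IsManifold 𝓘(ℂ, EP) ω P]
    [MulAction Gᵐᵒᵖ P] {pr : P → X} (hP : IsPrincipalBundle E EP G pr)
    -- the section `ψ` of `P(V) ⊗ S`
    (ψ : TwistedSection E EP ρ.toHolRep pr ℂ S) :
    (IsSemistable (higgsField E EP ρ B κ ψ) → IsSemistable ψ) ∧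
      (IsStable (higgsField E EP ρ B κ ψ) → IsStable ψ) := by
  -- Both implications feed the data given for `ψ` unchanged to the hypothesis on `μ(ψ)`. The degree
  -- is literally the same integer, so the strict inequality transfers just as the weak one does.
  refine ⟨fun h 𝔮 h𝔮 σ χ dχ hχ ha 𝔩 s h𝔩 hs hψ => ?_,
    fun h 𝔮 h𝔮 hproper σ χ dχ hχ ha 𝔩 s h𝔩 hs hψ => ?_⟩
  · exact h 𝔮 h𝔮 σ χ dχ hχ ha 𝔩 s h𝔩 hs (hψ.higgsField B κ)
  · exact h 𝔮 h𝔮 hproper σ χ dχ hχ ha 𝔩 s h𝔩 hs (hψ.higgsField B κ)
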